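/- Let $p\in[1,\infty)$ and $d\in\mathbb N$. Write points of $\mathbb R^{d+1}$ as $z=(x,t)$ with $x\in\mathbb R^d$ and $t\in\mathbb R$ (the last coordinate), and let $\|u\|_p=\big(\sum_i|u_i|^p\big)^{1/p}$ and $d_p(z,z')=\|z-z'\|_p$. Let $P(\mathbb R^{d+1})$ be the set of Borel probability measures on $\mathbb R^{d+1}$, and let $$P_p(\mathbb R^{d+1})=\Big\{\mu\in P(\mathbb R^{d+1}) : \int d_p(z_0,z)^p\,d\mu(z)<\infty\Big\},$$ where $z_0\in\mathbb R^{d+1}$ is arbitrary (the condition does not depend on $z_0$). For $w\in[0,1]$ put $$d_{p,w}\big((x,t),(y,s)\big)=\big(w\|x-y\|_p^p+(1-w)|t-s|^p\big)^{1/p}.$$ For $\alpha,\beta\in P(\mathbb R^{d+1})$ let $\Pi(\alpha,\beta)$ be the set of probability measures on $\mathbb R^{d+1}\times\mathbb R^{d+1}$ with marginals $\alpha$ and $\beta$, and define $$\mathcal D_p(\alpha,\beta)=\sup_{w\in[0,1]}\Big[\inf_{\pi\in\Pi(\alpha,\beta)}\int d_{p,w}(z,z')^p\,d\pi(z,z')\Big]^{1/p}\in[0,\infty].$$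 Let $(\mu_k)_{k\in\mathbb N}$ be a sequence in $P_p(\mathbb R^{d+1})$ and let $\mu\in P(\mathbb R^{d+1})$. Then the following two statements are equivalent: (i) $\mu_k$ converges weakly in $P_p(\mathbb R^{d+1})$ to $\mu$, that is, $\mu\in P_p(\mathbb R^{d+1})$, and for every bounded continuous function $\phi:\mathbb R^{d+1}\to\mathbb R$ and every $z_0\in\mathbb R^{d+1}$, $$\int\phi\,d\mu_k\to\int\phi\,d\mu\quad\text{and}\quad\int d_p(z_0,z)^p\,d\mu_k(z)\to\int d_p(z_0,z)^p\,d\mu(z);$$ (ii) $\mathcal D_p(\mu_k,\mu)\to0$. -/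

import Mathlib

open MeasureTheory Filter Topology
open scoped ENNReal BoundedContinuousFunction

noncomputable section

namespace TiOT

/-- The `ℓ^p` distance `‖x - y‖_p = (∑ i, |x i - y i| ^ p) ^ (1 / p)` on `ℝ^n`. -/
def lpDist (p : ℝ) {n : ℕ} (x y : Fin n → ℝ) : ℝ :=
  (∑ i, |x i - y i| ^ p) ^ (1 / p)

/-- The feature part `x ∈ ℝ^d` of a point `z = (x, t)` of `ℝ^(d+1)`. -/
def feature {d : ℕ} (z : Fin (d + 1) → ℝ) : Fin d → ℝ := fun i => z i.castSucc

/-- The time `t`, i.e. the last coordinate, of a point `z = (x, t)` of `ℝ^(d+1)`. -/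
def time {d : ℕ} (z : Fin (d + 1) → ℝ) : ℝ := z (Fin.last d)

/-- `d_{p,w}((x,t),(y,s)) = (w ‖x - y‖_p ^ p + (1 - w) |t - s| ^ p) ^ (1 / p)`. -/
def weightedDist (p w : ℝ) {d : ℕ} (z z' : Fin (d + 1) → ℝ) : ℝ :=
  (w * lpDist p (feature z) (feature z') ^ p + (1 - w) * |time z - time z'| ^ p) ^ (1 / p)

/-- The set `P_p(ℝ^n)` of Borel probability measures with finite `p`-th moment. -/
def FiniteMoment (p : ℝ) (n : ℕ) : Set (ProbabilityMeasure (Fin n → ℝ)) :=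
  {μ | ∀ z₀ : Fin n → ℝ,
    ∫⁻ z, ENNReal.ofReal (lpDist p z₀ z ^ p) ∂(μ : Measure (Fin n → ℝ)) < ∞}

/-- The set `Π(α, β)` of couplings: probability measures on the product with marginals
`α` and `β`. -/
def Couplings {n : ℕ} (α β : ProbabilityMeasure (Fin n → ℝ)) :
    Set (ProbabilityMeasure ((Fin n → ℝ) × (Fin n → ℝ))) :=
  {π | (∀ A : Set (Fin n → ℝ), MeasurableSet A →
          (π : Measure ((Fin n → ℝ) × (Fin n → ℝ))) (A ×ˢ Set.univ) = (α : Measure _) A) ∧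
       (∀ B : Set (Fin n → ℝ), MeasurableSet B →
          (π : Measure ((Fin n → ℝ) × (Fin n → ℝ))) (Set.univ ×ˢ B) = (β : Measure _) B)}

/-- The transport distance `W_{p,w}(α, β)` of order `p` for the cost `d_{p,w} ^ p`, with values
in `[0, ∞]` (it is finite on measures with finite `p`-th moment). -/
def weightedWasserstein (p w : ℝ) {d : ℕ} (α β : ProbabilityMeasure (Fin (d + 1) → ℝ)) : ℝ≥0∞ :=
  (⨅ π ∈ Couplings α β,
    ∫⁻ q, ENNReal.ofReal (weightedDist p w q.1 q.2 ^ p)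
      ∂(π : Measure ((Fin (d + 1) → ℝ) × (Fin (d + 1) → ℝ)))) ^ (1 / p)

/-- The time-integrated optimal transport distance
`D_p(α, β) = max_{w ∈ [0,1]} W_{p,w}(α, β)`. -/
def tiotDist (p : ℝ) {d : ℕ} (α β : ProbabilityMeasure (Fin (d + 1) → ℝ)) : ℝ≥0∞ :=
  ⨆ w ∈ Set.Icc (0 : ℝ) 1, weightedWasserstein p w α β

/-- Weak convergence in `P_p(ℝ^n)` of a sequence to `μ`: all measures belong to `P_p(ℝ^n)`,
integrals of bounded continuous functions converge, and so do the `p`-th moments about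
every point. -/
structure WeaklyConvergesInPp (p : ℝ) {n : ℕ} (μs : ℕ → ProbabilityMeasure (Fin n → ℝ))
    (μ : ProbabilityMeasure (Fin n → ℝ)) : Prop where
  mem_seq : ∀ k, μs k ∈ FiniteMoment p n
  mem_limit : μ ∈ FiniteMoment p n
  tendsto_integral : ∀ φ : (Fin n → ℝ) →ᵇ ℝ,
    Tendsto (fun k => ∫ z, φ z ∂(μs k : Measure (Fin n → ℝ))) atTop
      (𝓝 (∫ z, φ z ∂(μ : Measure (Fin n → ℝ))))
  tendsto_moment : ∀ z₀ : Fin n → ℝ,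
    Tendsto (fun k => ∫ z, lpDist p z₀ z ^ p ∂(μs k : Measure (Fin n → ℝ))) atTop
      (𝓝 (∫ z, lpDist p z₀ z ^ p ∂(μ : Measure (Fin n → ℝ))))

end TiOT

end

/-!
Since `½ ‖z - z'‖_p ^ p = d_{p,1/2}(z, z') ^ p` and `d_{p,w} ≤ d_p`, the distance `D_p` lies between
constant multiples of the `ℓ^p` Wasserstein distance of order `p`, so the claim is the classical
characterization of Wasserstein convergence, which holds in any separable metric space.

If `ν_i → μ` weakly, cut the space into countably many small pieces whose frontiers are `μ`-null.
Then `ν_i` and `μ` asymptotically give the same mass to each piece, and transporting this common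
mass within each piece couples `ν_i` and `μ` so that the two points are close with probability near
`1`.
Convergence of the moments makes the `p`-th powers of the distance to a fixed point uniformly
integrable, so the remaining mass contributes little to the cost. Conversely, by Minkowski's
inequality the `p`-th roots of the moments differ by at most the Wasserstein distance, and the
integrals of a `K`-Lipschitz function differ by at most `K` times it.
-/

namespace TiOT

open scoped NNReal Function

section Coupling

variable {E F : Type*} [MeasurableSpace E] [MeasurableSpace F] {α : Measure E} {β : Measure F}

/-- `π` is a coupling of `α` and `β`, also called a transport plan from `α` to `β`: its marginals
are `α` and `β`. -/
structure IsCoupling (π : Measure (E × F)) (α : Measure E) (β : Measure F) : Prop where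
  fst_eq : π.fst = α
  snd_eq : π.snd = β

namespace IsCoupling

variable {π : Measure (E × F)}

theorem swap (h : IsCoupling π α β) : IsCoupling (π.map Prod.swap) β α :=
  ⟨Measure.fst_map_swap.trans h.snd_eq, Measure.snd_map_swap.trans h.fst_eq⟩

theorem measure_univ (h : IsCoupling π α β) : π Set.univ = α Set.univ := by
  rw [← h.fst_eq, Measure.fst_univ]

theorem isProbabilityMeasure [IsProbabilityMeasure α] (h : IsCoupling π α β) :
    IsProbabilityMeasure π :=
  ⟨h.measure_univ.trans MeasureTheory.measure_univ⟩

theorem measurePreserving_fst (h : IsCoupling π α β) : MeasurePreserving Prod.fst π α :=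
  ⟨measurable_fst, h.fst_eq⟩

theorem measurePreserving_snd (h : IsCoupling π α β) : MeasurePreserving Prod.snd π β :=
  ⟨measurable_snd, h.snd_eq⟩

end IsCoupling

theorem inv_max_mul_mul_eq_min {a b : ℝ≥0∞} (ha : a ≠ ∞) (hb : b ≠ ∞) :
    (max a b)⁻¹ * (a * b) = min a b := by
  rcases eq_or_ne (max a b) 0 with h | h
  · simp_all
  · rw [← max_mul_min a b, ← mul_assoc, ENNReal.inv_mul_cancel h (by simp [ha, hb]), one_mul]

/-- The product measure, rescaled so that it transports the mass `min (α univ) (β univ)`: as much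
of `α` into `β` as the total masses allow. -/
noncomputable def matching (α : Measure E) (β : Measure F) : Measure (E × F) :=
  (max (α Set.univ) (β Set.univ))⁻¹ • α.prod β

theorem matching_univ [IsFiniteMeasure α] [IsFiniteMeasure β] :
    matching α β Set.univ = min (α Set.univ) (β Set.univ) := by
  rw [matching, Measure.smul_apply, ← Set.univ_prod_univ, Measure.prod_prod, smul_eq_mul,
    inv_max_mul_mul_eq_min (measure_ne_top _ _) (measure_ne_top _ _)]

theorem fst_matching_le [SFinite β] : (matching α β).fst ≤ α := by
  rw [matching, Measure.fst, Measure.map_smul, Measure.map_fst_prod, smul_smul]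
  refine Measure.le_iff.2 fun s _ => mul_le_of_le_one_left' ?_
  rw [mul_comm, ← div_eq_mul_inv]
  exact ENNReal.div_le_of_le_mul (by simp)

theorem map_swap_matching [SFinite α] [SFinite β] :
    (matching α β).map Prod.swap = matching β α := by
  rw [matching, matching, Measure.map_smul, Measure.prod_swap, max_comm]

theorem snd_matching_le [SFinite α] [SFinite β] : (matching α β).snd ≤ β := by
  rw [← Measure.fst_map_swap, map_swap_matching]
  exact fst_matching_le

theorem isCoupling_matching [IsFiniteMeasure α] [IsFiniteMeasure β]
    (h : α Set.univ = β Set.univ) : IsCoupling (matching α β) α β := by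
  have := isFiniteMeasure_of_le α (fst_matching_le (α := α) (β := β))
  have := isFiniteMeasure_of_le β (snd_matching_le (α := α) (β := β))
  exact ⟨Measure.eq_of_le_of_measure_univ_eq fst_matching_le (by
      rw [Measure.fst_univ, matching_univ, h, min_self]),
    Measure.eq_of_le_of_measure_univ_eq snd_matching_le (by
      rw [Measure.snd_univ, matching_univ, h, min_self])⟩

theorem exists_isCoupling_ge [IsFiniteMeasure α] [IsFiniteMeasure β]
    (h : α Set.univ = β Set.univ) {ρ : Measure (E × F)} (hfst : ρ.fst ≤ α) (hsnd : ρ.snd ≤ β) :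
    ∃ π, ρ ≤ π ∧ IsCoupling π α β := by
  have : IsFiniteMeasure ρ.fst := isFiniteMeasure_of_le α hfst
  have : IsFiniteMeasure ρ.snd := isFiniteMeasure_of_le β hsnd
  have hmass : (α - ρ.fst) Set.univ = (β - ρ.snd) Set.univ := by
    rw [Measure.sub_apply .univ hfst, Measure.sub_apply .univ hsnd, h, Measure.fst_univ,
      Measure.snd_univ]
  have hrest := isCoupling_matching hmass
  refine ⟨matching (α - ρ.fst) (β - ρ.snd) + ρ, Measure.le_add_left le_rfl, ?_, ?_⟩
  · rw [Measure.fst_add, hrest.fst_eq, Measure.sub_add_cancel_of_le hfst]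
  · rw [Measure.snd_add, hrest.snd_eq, Measure.sub_add_cancel_of_le hsnd]

theorem sum_le_of_le_restrict {ι : Type*} [Countable ι] {A : ι → Set E} {ρ : ι → Measure E}
    (hA : ∀ i, MeasurableSet (A i)) (hdisj : Pairwise (Disjoint on A))
    (hρ : ∀ i, ρ i ≤ α.restrict (A i)) : Measure.sum ρ ≤ α :=
  calc Measure.sum ρ ≤ Measure.sum fun i => α.restrict (A i) := Measure.le_iff.2 fun s hs => by
        simpa only [Measure.sum_apply _ hs] using ENNReal.tsum_le_tsum fun i => hρ i s
    _ = α.restrict (⋃ i, A i) := (Measure.restrict_iUnion hdisj hA).symm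
    _ ≤ α := Measure.restrict_le_self

theorem exists_isCoupling_tsum_min_le [IsFiniteMeasure α] [IsFiniteMeasure β]
    (h : α Set.univ = β Set.univ) {ι : Type*} [Countable ι] {A : ι → Set E} {B : ι → Set F}
    (hA : ∀ i, MeasurableSet (A i)) (hB : ∀ i, MeasurableSet (B i))
    (hAdisj : Pairwise (Disjoint on A)) (hBdisj : Pairwise (Disjoint on B)) :
    ∃ π, IsCoupling π α β ∧ ∑' i, min (α (A i)) (β (B i)) ≤ π (⋃ i, A i ×ˢ B i) := by
  set ρ : ι → Measure (E × F) := fun i => matching (α.restrict (A i)) (β.restrict (B i)) with hρ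
  have hfst : (Measure.sum ρ).fst ≤ α := by
    rw [Measure.fst_sum]
    exact sum_le_of_le_restrict hA hAdisj fun i => fst_matching_le
  have hsnd : (Measure.sum ρ).snd ≤ β := by
    rw [Measure.snd_sum]
    exact sum_le_of_le_restrict hB hBdisj fun i => snd_matching_le
  obtain ⟨π, hle, hπ⟩ := exists_isCoupling_ge h hfst hsnd
  refine ⟨π, hπ, ?_⟩
  have hmass : ∀ i, ρ i (A i ×ˢ B i) = min (α (A i)) (β (B i)) := fun i => by
    simp only [hρ, matching, Measure.smul_apply, Measure.prod_prod, Measure.restrict_apply_self,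
      Measure.restrict_apply_univ, smul_eq_mul]
    exact inv_max_mul_mul_eq_min (measure_ne_top _ _) (measure_ne_top _ _)
  calc ∑' i, min (α (A i)) (β (B i)) = ∑' i, ρ i (A i ×ˢ B i) := by simp only [hmass]
    _ ≤ ∑' i, ρ i (⋃ j, A j ×ˢ B j) :=
        ENNReal.tsum_le_tsum fun i => measure_mono (Set.subset_iUnion (fun j => A j ×ˢ B j) i)
    _ ≤ Measure.sum ρ (⋃ j, A j ×ˢ B j) := Measure.le_sum_apply _ _
    _ ≤ π (⋃ j, A j ×ˢ B j) := hle _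

end Coupling

section WeakConvergence

variable {E : Type*} [MeasurableSpace E] [PseudoMetricSpace E] [TopologicalSpace.SeparableSpace E]
  [OpensMeasurableSpace E]

theorem exists_partition_null_frontier [Nonempty E] (μ : Measure E) [SFinite μ] {δ : ℝ≥0∞}
    (hδ : 0 < δ) :
    ∃ A : ℕ → Set E, (∀ n, MeasurableSet (A n)) ∧ Pairwise (Disjoint on A) ∧ ⋃ n, A n = Set.univ ∧
      (∀ n, μ (frontier (A n)) = 0) ∧ ∀ n, ∀ x ∈ A n, ∀ y ∈ A n, edist x y < δ := by
  obtain ⟨r, hr, hrδ⟩ := ENNReal.lt_iff_exists_nnreal_btwn.1 (ENNReal.half_pos hδ.ne')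
  have hr' : (0 : ℝ) < r := by exact_mod_cast hr
  set c := TopologicalSpace.denseSeq E
  choose s hs hfrontier using fun n => exists_null_frontier_thickening μ {c n} (half_lt_self hr')
  simp only [Metric.thickening_singleton] at hfrontier
  set B : ℕ → Set E := fun n => Metric.ball (c n) (s n)
  have hcover : ⋃ n, B n = Set.univ := Set.eq_univ_of_forall fun x => by
    obtain ⟨n, hn⟩ := (TopologicalSpace.denseRange_denseSeq E).exists_dist_lt x (half_pos hr')
    exact Set.mem_iUnion.2 ⟨n, hn.trans (hs n).1⟩
  refine ⟨disjointed B, fun n => .disjointed (fun _ => measurableSet_ball) n,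
    disjoint_disjointed B, iUnion_disjointed.trans hcover, fun n => ?_, fun n x hx y hy => ?_⟩
  · refine disjointedRec (p := fun t => μ (frontier t) = 0) (fun t i ht => ?_) (hfrontier n)
    rw [Set.sdiff_eq]
    exact null_frontier_inter ht (by rw [frontier_compl, hfrontier i])
  · have hball : ∀ z ∈ disjointed B n, edist z (c n) < δ / 2 := fun z hz =>
      have hz' : dist z (c n) < r := (disjointed_subset B n hz).trans (hs n).2
      (edist_lt_coe.2 hz').trans hrδ
    calc edist x y ≤ _ := edist_triangle_right _ _ (c n)
      _ < δ / 2 + δ / 2 := ENNReal.add_lt_add (hball x hx) (hball y hy)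
      _ = δ := ENNReal.add_halves δ

theorem eventually_exists_isCoupling_measure_le {ι : Type*} {l : Filter ι}
    {ν : ι → ProbabilityMeasure E} {μ : ProbabilityMeasure E} (hν : Tendsto ν l (𝓝 μ))
    {δ ε : ℝ≥0∞} (hδ : 0 < δ) (hε : 0 < ε) :
    ∀ᶠ i in l, ∃ π : Measure (E × E), IsCoupling π (ν i) μ ∧ π {q | δ ≤ edist q.1 q.2} ≤ ε := by
  have : Nonempty E := nonempty_of_isProbabilityMeasure μ.toMeasure
  obtain ⟨A, hA, hdisj, hcover, hfrontier, hsmall⟩ :=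
    exists_partition_null_frontier μ.toMeasure hδ
  have hsum : Tendsto (fun m => ∑ n ∈ Finset.range m, μ.toMeasure (A n)) atTop (𝓝 1) := by
    have := ENNReal.tendsto_nat_tsum fun n => μ.toMeasure (A n)
    rwa [← measure_iUnion hdisj hA, hcover, measure_univ] at this
  obtain ⟨m, hm⟩ := (hsum.eventually_const_lt
    (ENNReal.sub_lt_self ENNReal.one_ne_top one_ne_zero hε.ne')).exists
  have hmin : Tendsto
      (fun i => ∑ n ∈ Finset.range m, min ((ν i).toMeasure (A n)) (μ.toMeasure (A n))) l
      (𝓝 (∑ n ∈ Finset.range m, μ.toMeasure (A n))) :=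
    tendsto_finsetSum _ fun n _ => by
      simpa only [min_self] using (ProbabilityMeasure.tendsto_measure_of_null_frontier_of_tendsto'
        hν (hfrontier n)).min (tendsto_const_nhds (x := μ.toMeasure (A n)))
  filter_upwards [hmin.eventually_const_lt hm] with i hi
  obtain ⟨π, hπ, hmass⟩ := exists_isCoupling_tsum_min_le
    (α := (ν i).toMeasure) (β := μ.toMeasure) (by simp) hA hA hdisj hdisj
  have := hπ.isProbabilityMeasure
  have hmeas : MeasurableSet (⋃ n, A n ×ˢ A n) := .iUnion fun n => (hA n).prod (hA n)
  refine ⟨π, hπ, ?_⟩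
  calc π {q | δ ≤ edist q.1 q.2} ≤ π (⋃ n, A n ×ˢ A n)ᶜ := measure_mono fun q hq hq' => by
        obtain ⟨n, hn⟩ := Set.mem_iUnion.1 hq'
        exact (hsmall n _ hn.1 _ hn.2).not_ge hq
    _ = 1 - π (⋃ n, A n ×ˢ A n) := prob_compl_eq_one_sub hmeas
    _ ≤ ε := tsub_le_iff_tsub_le.1 <| hi.le.trans <| (ENNReal.sum_le_tsum _).trans hmass

end WeakConvergence

section UniformIntegrability

variable {E : Type*} [MeasurableSpace E] {N : E → ℝ≥0∞}

theorem tendsto_lintegral_tsub_const_atTop {μ : Measure E} (hN : Measurable N)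
    (hfin : ∫⁻ x, N x ∂μ ≠ ∞) :
    Tendsto (fun R : ℝ≥0 => ∫⁻ x, N x - R ∂μ) atTop (𝓝 0) := by
  rw [← lintegral_zero (μ := μ)]
  refine tendsto_lintegral_filter_of_dominated_convergence N
    (.of_forall fun R => hN.sub_const _) (.of_forall fun R => .of_forall fun x => tsub_le_self)
    hfin ?_
  filter_upwards [ae_lt_top hN hfin] with x hx
  refine tendsto_const_nhds.congr' ?_
  filter_upwards [eventually_ge_atTop (N x).toNNReal] with R hR
  exact (tsub_eq_zero_of_le ((ENNReal.toNNReal_le_toNNReal hx.ne ENNReal.coe_ne_top).1 hR)).symm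

variable [TopologicalSpace E] [OpensMeasurableSpace E] {ι : Type*} {l : Filter ι}
  {ν : ι → ProbabilityMeasure E} {μ : ProbabilityMeasure E}

theorem tendsto_lintegral_of_continuous_of_le_const (hν : Tendsto ν l (𝓝 μ)) (hN : Continuous N)
    {R : ℝ≥0} (hR : ∀ x, N x ≤ R) :
    Tendsto (fun i => ∫⁻ x, N x ∂(ν i).toMeasure) l (𝓝 (∫⁻ x, N x ∂μ.toMeasure)) := by
  have hne x : N x ≠ ∞ := ne_top_of_le_ne_top ENNReal.coe_ne_top (hR x)
  have hle x : (N x).toNNReal ≤ R := ENNReal.toNNReal_mono ENNReal.coe_ne_top (hR x)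
  have hdist x y : dist (N x).toNNReal (N y).toNNReal ≤ R :=
    (Real.dist_le_of_mem_Icc ⟨(N x).toNNReal.2, hle x⟩ ⟨(N y).toNNReal.2, hle y⟩).trans_eq
      (sub_zero _)
  let f : E →ᵇ ℝ≥0 := .mkOfBound
    ⟨fun x => (N x).toNNReal, ENNReal.continuousOn_toNNReal.comp_continuous hN hne⟩ R hdist
  simpa [f, hne] using ProbabilityMeasure.tendsto_iff_forall_lintegral_tendsto.1 hν f

theorem tendsto_lintegral_tsub_const (hν : Tendsto ν l (𝓝 μ)) (hN : Continuous N)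
    (hmoment : Tendsto (fun i => ∫⁻ x, N x ∂(ν i).toMeasure) l (𝓝 (∫⁻ x, N x ∂μ.toMeasure)))
    (R : ℝ≥0) :
    Tendsto (fun i => ∫⁻ x, N x - R ∂(ν i).toMeasure) l
      (𝓝 (∫⁻ x, N x - R ∂μ.toMeasure)) := by
  have hmin_ne_top (α : ProbabilityMeasure E) : ∫⁻ x, min (N x) R ∂α.toMeasure ≠ ∞ :=
    ne_top_of_le_ne_top (by simp) (lintegral_mono fun x => min_le_right (N x) R)
  have htsub (α : ProbabilityMeasure E) : ∫⁻ x, N x - R ∂α.toMeasure =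
      ∫⁻ x, N x ∂α.toMeasure - ∫⁻ x, min (N x) R ∂α.toMeasure := by
    refine ENNReal.eq_sub_of_add_eq (hmin_ne_top α) ?_
    rw [← lintegral_add_right _ (hN.measurable.min measurable_const)]
    simp only [tsub_add_min]
  simp only [htsub]
  exact ENNReal.Tendsto.sub hmoment (tendsto_lintegral_of_continuous_of_le_const hν
    (hN.min continuous_const) fun x => min_le_right _ _) (.inr (hmin_ne_top μ))

end UniformIntegrability

section TransportCost

variable {E F : Type*} [MeasurableSpace E] [MeasurableSpace F] {c : E → F → ℝ≥0∞}
  {α : Measure E} {β : Measure F}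

/-- The optimal transport cost between `α` and `β` for the cost function `c`: the infimum over all
couplings of the expected cost. It is `∞` if there is no coupling. -/
noncomputable def transportCost (c : E → F → ℝ≥0∞) (α : Measure E) (β : Measure F) : ℝ≥0∞ :=
  ⨅ (π : Measure (E × F)) (_ : IsCoupling π α β), ∫⁻ q, c q.1 q.2 ∂π

theorem IsCoupling.transportCost_le {π : Measure (E × F)} (hπ : IsCoupling π α β) :
    transportCost c α β ≤ ∫⁻ q, c q.1 q.2 ∂π :=
  iInf₂_le π hπ

theorem transportCost_mono {c' : E → F → ℝ≥0∞} (h : ∀ x y, c x y ≤ c' x y) :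
    transportCost c α β ≤ transportCost c' α β :=
  iInf₂_mono fun _ _ => lintegral_mono fun _ => h _ _

theorem transportCost_const_mul {r : ℝ≥0∞} (hr₀ : r ≠ 0) (hr : r ≠ ∞) :
    transportCost (fun x y => r * c x y) α β = r * transportCost c α β := by
  simp only [transportCost, lintegral_const_mul' r _ hr, ENNReal.mul_iInf_of_ne hr₀ hr]

theorem transportCost_swap_le :
    transportCost (fun y x => c x y) β α ≤ transportCost c α β :=
  le_iInf₂ fun _ hπ => hπ.swap.transportCost_le.trans_eq
    (lintegral_map_equiv _ MeasurableEquiv.prodComm)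

theorem transportCost_swap : transportCost (fun y x => c x y) β α = transportCost c α β :=
  transportCost_swap_le.antisymm transportCost_swap_le

theorem le_transportCost_rpow {a : ℝ≥0∞} {p : ℝ} (hp : 0 < p)
    (h : ∀ π, IsCoupling π α β → a ≤ (∫⁻ q, c q.1 q.2 ∂π) ^ (1 / p)) :
    a ≤ transportCost c α β ^ (1 / p) := by
  simp only [one_div, ENNReal.le_rpow_inv_iff hp] at h ⊢
  exact le_iInf₂ h

end TransportCost

section PthPower

variable {E : Type*} [PseudoEMetricSpace E] {p : ℝ}

theorem edist_rpow_le (hp : 1 ≤ p) (z x y : E) :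
    edist x y ^ p ≤ 2 ^ (p - 1) * (edist z x ^ p + edist z y ^ p) :=
  (ENNReal.rpow_le_rpow (edist_triangle_left x y z) (by linarith)).trans
    (ENNReal.rpow_add_le_mul_rpow_add_rpow _ _ hp)

variable [MeasurableSpace E] {α β : Measure E}

theorem transportCost_edist_rpow_comm :
    transportCost (fun x y => edist x y ^ p) α β =
      transportCost (fun x y => edist x y ^ p) β α := by
  simp only [← transportCost_swap (α := α), edist_comm]

variable [SecondCountableTopology E] [OpensMeasurableSpace E]

theorem IsCoupling.lintegral_edist_rpow_le {π : Measure (E × E)} (hπ : IsCoupling π α β)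
    (hp : 1 ≤ p) (z : E) (δ R : ℝ≥0∞) :
    ∫⁻ q, edist q.1 q.2 ^ p ∂π ≤ δ ^ p * α Set.univ + 2 ^ (p - 1) *
      (2 * R * π {q | δ ≤ edist q.1 q.2} + ∫⁻ x, edist z x ^ p - R ∂α +
        ∫⁻ y, edist z y ^ p - R ∂β) := by
  set far : Set (E × E) := {q | δ ≤ edist q.1 q.2}
  have hfar : MeasurableSet far := measurableSet_le measurable_const measurable_edist
  have hN : Measurable fun x => edist z x ^ p - R := by fun_prop
  have hpointwise (q : E × E) : edist q.1 q.2 ^ p ≤ δ ^ p + 2 ^ (p - 1) *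
      (far.indicator (fun _ => 2 * R) q + (edist z q.1 ^ p - R) + (edist z q.2 ^ p - R)) := by
    by_cases hq : q ∈ far
    · rw [Set.indicator_of_mem hq]
      calc edist q.1 q.2 ^ p ≤ 2 ^ (p - 1) * (edist z q.1 ^ p + edist z q.2 ^ p) :=
            edist_rpow_le hp z _ _
        _ ≤ 2 ^ (p - 1) * ((R + (edist z q.1 ^ p - R)) + (R + (edist z q.2 ^ p - R))) := by
            gcongr <;> exact le_add_tsub
        _ = 2 ^ (p - 1) * (2 * R + (edist z q.1 ^ p - R) + (edist z q.2 ^ p - R)) := by ring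
        _ ≤ _ := le_add_self
    · exact (ENNReal.rpow_le_rpow (not_le.1 hq).le (by linarith)).trans le_self_add
  calc ∫⁻ q, edist q.1 q.2 ^ p ∂π
      ≤ ∫⁻ q, δ ^ p + 2 ^ (p - 1) * (far.indicator (fun _ => 2 * R) q +
          (edist z q.1 ^ p - R) + (edist z q.2 ^ p - R)) ∂π := lintegral_mono hpointwise
    _ = δ ^ p * π Set.univ + 2 ^ (p - 1) * (2 * R * π far + ∫⁻ q, edist z q.1 ^ p - R ∂π +
          ∫⁻ q, edist z q.2 ^ p - R ∂π) := by
        rw [lintegral_add_left measurable_const, lintegral_const,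
          lintegral_const_mul _ (by fun_prop), lintegral_add_left (by fun_prop),
          lintegral_add_left (by fun_prop), lintegral_indicator_const hfar]
    _ = _ := by
        rw [hπ.measure_univ, hπ.measurePreserving_fst.lintegral_comp hN,
          hπ.measurePreserving_snd.lintegral_comp hN]

end PthPower

section Sufficiency

variable {E : Type*} [MeasurableSpace E] [PseudoMetricSpace E] [SecondCountableTopology E]
  [OpensMeasurableSpace E] {p : ℝ}

theorem tendsto_transportCost_edist_rpow {ι : Type*} {l : Filter ι}
    {ν : ι → ProbabilityMeasure E} {μ : ProbabilityMeasure E} (hp : 1 ≤ p)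
    (hν : Tendsto ν l (𝓝 μ)) (z : E) (hfin : ∫⁻ x, edist z x ^ p ∂μ.toMeasure ≠ ∞)
    (hmoment : Tendsto (fun i => ∫⁻ x, edist z x ^ p ∂(ν i).toMeasure) l
      (𝓝 (∫⁻ x, edist z x ^ p ∂μ.toMeasure))) :
    Tendsto (fun i => transportCost (fun x y => edist x y ^ p) (ν i).toMeasure μ) l (𝓝 0) := by
  have hp₀ : 0 < p := by linarith
  refine ENNReal.tendsto_nhds_zero.2 fun ε hε => ?_
  obtain ⟨η, hη, hηε⟩ := ENNReal.exists_nnreal_pos_mul_lt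
    (a := 1 + 2 ^ (p - 1) * 4) (b := ε) (by finiteness) hε.ne'
  have hη' : (0 : ℝ≥0∞) < η := by exact_mod_cast hη
  obtain ⟨R, hR⟩ := ((tendsto_lintegral_tsub_const_atTop (by fun_prop) hfin).eventually_lt_const
    hη').exists
  filter_upwards [eventually_exists_isCoupling_measure_le hν
    (ENNReal.rpow_pos hη' ENNReal.coe_ne_top : 0 < (η : ℝ≥0∞) ^ p⁻¹)
    (ENNReal.div_pos hη'.ne' ENNReal.coe_ne_top : 0 < (η : ℝ≥0∞) / R),
    (tendsto_lintegral_tsub_const hν (by fun_prop) hmoment R).eventually_lt_const hR]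
    with i ⟨π, hπ, hfar⟩ hRi
  calc transportCost (fun x y => edist x y ^ p) (ν i).toMeasure μ
      ≤ ∫⁻ q, edist q.1 q.2 ^ p ∂π := hπ.transportCost_le
    _ ≤ _ := hπ.lintegral_edist_rpow_le hp z (η ^ p⁻¹) R
    _ ≤ η * 1 + 2 ^ (p - 1) * (2 * η + η + η) := by
        rw [ENNReal.rpow_inv_rpow hp₀.ne', measure_univ, mul_assoc]
        have := (mul_le_mul_right hfar (R : ℝ≥0∞)).trans ENNReal.mul_div_le
        gcongr
    _ = (1 + 2 ^ (p - 1) * 4) * η := by ring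
    _ ≤ ε := (mul_comm _ _).trans_le hηε.le

end Sufficiency

section Necessity

variable {E : Type*} [MeasurableSpace E] [PseudoEMetricSpace E] [SecondCountableTopology E]
  [OpensMeasurableSpace E] {α β : Measure E} {p : ℝ}

theorem IsCoupling.rpow_lintegral_edist_rpow_le {π : Measure (E × E)} (hπ : IsCoupling π α β)
    (hp : 1 ≤ p) (z : E) :
    (∫⁻ x, edist z x ^ p ∂α) ^ (1 / p) ≤
      (∫⁻ y, edist z y ^ p ∂β) ^ (1 / p) + (∫⁻ q, edist q.1 q.2 ^ p ∂π) ^ (1 / p) := by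
  have : 0 ≤ p := by linarith
  have hN : Measurable fun x => edist z x ^ p := by fun_prop
  calc (∫⁻ x, edist z x ^ p ∂α) ^ (1 / p) = (∫⁻ q, edist z q.1 ^ p ∂π) ^ (1 / p) := by
        rw [hπ.measurePreserving_fst.lintegral_comp hN]
    _ ≤ (∫⁻ q, (edist z q.2 + edist q.1 q.2) ^ p ∂π) ^ (1 / p) := by
        gcongr with q
        exact edist_triangle_right _ _ _
    _ ≤ (∫⁻ q, edist z q.2 ^ p ∂π) ^ (1 / p) + (∫⁻ q, edist q.1 q.2 ^ p ∂π) ^ (1 / p) :=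
        ENNReal.lintegral_Lp_add_le (by fun_prop) (by fun_prop) hp
    _ = _ := by rw [hπ.measurePreserving_snd.lintegral_comp hN]

theorem rpow_lintegral_edist_rpow_le_add_transportCost (hp : 1 ≤ p) (z : E) :
    (∫⁻ x, edist z x ^ p ∂α) ^ (1 / p) ≤ (∫⁻ y, edist z y ^ p ∂β) ^ (1 / p) +
      transportCost (fun x y => edist x y ^ p) α β ^ (1 / p) := by
  rw [← tsub_le_iff_left]
  exact le_transportCost_rpow (by linarith) fun π hπ =>
    tsub_le_iff_left.2 (hπ.rpow_lintegral_edist_rpow_le hp z)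

theorem IsCoupling.edist_integral_le {π : Measure (E × E)} [IsProbabilityMeasure π]
    (hπ : IsCoupling π α β) (hp : 1 ≤ p) {f : E → ℝ} {K : ℝ≥0} (hf : LipschitzWith K f)
    (hfα : Integrable f α) (hfβ : Integrable f β) :
    edist (∫ x, f x ∂α) (∫ y, f y ∂β) ≤ K * (∫⁻ q, edist q.1 q.2 ^ p ∂π) ^ (1 / p) := by
  have hmono := eLpNorm'_le_eLpNorm'_of_exponent_le one_pos hp π
    (f := fun q : E × E => edist q.1 q.2) (by fun_prop)
  simp only [eLpNorm', enorm_eq_self, ENNReal.rpow_one, div_one] at hmono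
  calc edist (∫ x, f x ∂α) (∫ y, f y ∂β) = edist (∫ q, f q.1 ∂π) (∫ q, f q.2 ∂π) := by
        obtain ⟨rfl, rfl⟩ := hπ
        rw [Measure.fst, Measure.snd, integral_map (by fun_prop) hfα.aestronglyMeasurable,
          integral_map (by fun_prop) hfβ.aestronglyMeasurable]
    _ ≤ ∫⁻ q, edist (f q.1) (f q.2) ∂π := edist_integral_le_lintegral_edist
        (hπ.measurePreserving_fst.integrable_comp_of_integrable hfα)
        (hπ.measurePreserving_snd.integrable_comp_of_integrable hfβ)
    _ ≤ ∫⁻ q, K * edist q.1 q.2 ∂π := lintegral_mono fun q => hf q.1 q.2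
    _ = K * ∫⁻ q, edist q.1 q.2 ∂π := lintegral_const_mul' _ _ ENNReal.coe_ne_top
    _ ≤ K * (∫⁻ q, edist q.1 q.2 ^ p ∂π) ^ (1 / p) := by gcongr

theorem edist_integral_le_mul_transportCost [IsProbabilityMeasure α] (hp : 1 ≤ p) {f : E → ℝ}
    {K : ℝ≥0} (hK : K ≠ 0) (hf : LipschitzWith K f) (hfα : Integrable f α) (hfβ : Integrable f β) :
    edist (∫ x, f x ∂α) (∫ y, f y ∂β) ≤
      K * transportCost (fun x y => edist x y ^ p) α β ^ (1 / p) := by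
  have hK' : (K : ℝ≥0∞) ≠ 0 := by exact_mod_cast hK
  rw [← ENNReal.div_le_iff' hK' ENNReal.coe_ne_top]
  refine le_transportCost_rpow (by linarith) fun π hπ => ?_
  have := hπ.isProbabilityMeasure
  rw [ENNReal.div_le_iff' hK' ENNReal.coe_ne_top]
  exact hπ.edist_integral_le hp hf hfα hfβ

variable {ι : Type*} {l : Filter ι} {ν : ι → ProbabilityMeasure E} {μ : ProbabilityMeasure E}

theorem tendsto_of_tendsto_transportCost [l.IsCountablyGenerated] (hp : 1 ≤ p)
    (h : Tendsto (fun i => transportCost (fun x y => edist x y ^ p) (ν i).toMeasure μ) l (𝓝 0)) :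
    Tendsto ν l (𝓝 μ) := by
  refine tendsto_iff_forall_lipschitz_integral_tendsto.2 fun f hbdd ⟨K, hf⟩ => ?_
  have hint (α : ProbabilityMeasure E) : Integrable f α.toMeasure := by
    obtain ⟨C, hC⟩ := hbdd
    exact (BoundedContinuousFunction.mkOfBound ⟨f, hf.continuous⟩ C hC).integrable _
  have hbound := ENNReal.Tendsto.const_mul (h.ennrpow_const (1 / p))
    (.inr (ENNReal.coe_ne_top (r := K + 1)))
  rw [ENNReal.zero_rpow_of_pos (by positivity), mul_zero] at hbound
  refine tendsto_iff_edist_tendsto_0.2 (tendsto_of_tendsto_of_tendsto_of_le_of_le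
    tendsto_const_nhds hbound (fun _ => zero_le) fun i => ?_)
  exact edist_integral_le_mul_transportCost hp (by positivity) (hf.weaken le_self_add) (hint _)
    (hint _)

theorem lintegral_edist_rpow_ne_top_of_transportCost_ne_top (hp : 1 ≤ p) {z : E}
    (hα : ∫⁻ x, edist z x ^ p ∂α ≠ ∞) (h : transportCost (fun x y => edist x y ^ p) α β ≠ ∞) :
    ∫⁻ y, edist z y ^ p ∂β ≠ ∞ := by
  have : 0 < p := by linarith
  rw [transportCost_edist_rpow_comm] at h
  have hroot := rpow_lintegral_edist_rpow_le_add_transportCost (α := β) (β := α) hp z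
  contrapose! hroot with htop
  rw [htop, ENNReal.top_rpow_of_pos (by positivity)]
  finiteness

theorem tendsto_lintegral_edist_rpow_of_tendsto_transportCost (hp : 1 ≤ p) {z : E}
    (hfin : ∫⁻ x, edist z x ^ p ∂μ.toMeasure ≠ ∞)
    (h : Tendsto (fun i => transportCost (fun x y => edist x y ^ p) (ν i).toMeasure μ) l (𝓝 0)) :
    Tendsto (fun i => ∫⁻ x, edist z x ^ p ∂(ν i).toMeasure) l
      (𝓝 (∫⁻ x, edist z x ^ p ∂μ.toMeasure)) := by
  have hp₀ : 0 < p := by linarith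
  have hT := h.ennrpow_const (1 / p)
  rw [ENNReal.zero_rpow_of_pos (by positivity)] at hT
  have hroot : Tendsto (fun i => (∫⁻ x, edist z x ^ p ∂(ν i).toMeasure) ^ (1 / p)) l
      (𝓝 ((∫⁻ x, edist z x ^ p ∂μ.toMeasure) ^ (1 / p))) := by
    refine tendsto_of_tendsto_of_tendsto_of_le_of_le
      (g := fun i => (∫⁻ x, edist z x ^ p ∂μ.toMeasure) ^ (1 / p) -
        transportCost (fun x y => edist x y ^ p) (ν i).toMeasure μ ^ (1 / p))
      (by simpa using ENNReal.Tendsto.sub tendsto_const_nhds hT (.inl (by finiteness)))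
      (by simpa using tendsto_const_nhds.add hT) (fun i => ?_)
      fun i => rpow_lintegral_edist_rpow_le_add_transportCost hp z
    rw [tsub_le_iff_right, transportCost_edist_rpow_comm]
    exact rpow_lintegral_edist_rpow_le_add_transportCost hp z
  simpa [← ENNReal.rpow_mul, hp₀.ne'] using hroot.ennrpow_const p

end Necessity

section Characterization

variable {E : Type*} [MeasurableSpace E] [PseudoMetricSpace E] [SecondCountableTopology E]
  [OpensMeasurableSpace E] {p : ℝ}

theorem tendsto_transportCost_edist_rpow_iff {ι : Type*} {l : Filter ι} [l.NeBot]
    [l.IsCountablyGenerated] {ν : ι → ProbabilityMeasure E} {μ : ProbabilityMeasure E} (hp : 1 ≤ p)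
    {z : E} (hν : ∀ᶠ i in l, ∫⁻ x, edist z x ^ p ∂(ν i).toMeasure ≠ ∞) :
    Tendsto (fun i => transportCost (fun x y => edist x y ^ p) (ν i).toMeasure μ) l (𝓝 0) ↔
      ∫⁻ x, edist z x ^ p ∂μ.toMeasure ≠ ∞ ∧ Tendsto ν l (𝓝 μ) ∧
        Tendsto (fun i => ∫⁻ x, edist z x ^ p ∂(ν i).toMeasure) l
          (𝓝 (∫⁻ x, edist z x ^ p ∂μ.toMeasure)) := by
  refine ⟨fun h => ?_, fun ⟨hfin, hweak, hmoment⟩ =>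
    tendsto_transportCost_edist_rpow hp hweak z hfin hmoment⟩
  obtain ⟨i, hi, hcost⟩ := (hν.and (h.eventually_lt_const ENNReal.zero_lt_top)).exists
  have hfin := lintegral_edist_rpow_ne_top_of_transportCost_ne_top hp hi hcost.ne
  exact ⟨hfin, tendsto_of_tendsto_transportCost hp h,
    tendsto_lintegral_edist_rpow_of_tendsto_transportCost hp hfin h⟩

end Characterization

section LpDist

variable {p : ℝ} {n : ℕ}

theorem edist_toLp_rpow (hp : 1 ≤ p) [Fact (1 ≤ ENNReal.ofReal p)] (x y : Fin n → ℝ) :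
    edist (WithLp.toLp (ENNReal.ofReal p) x) (WithLp.toLp (ENNReal.ofReal p) y) ^ p =
      ENNReal.ofReal (lpDist p x y ^ p) := by
  have hp₀ : 0 < p := by linarith
  have hpr : (ENNReal.ofReal p).toReal = p := ENNReal.toReal_ofReal hp₀.le
  rw [← ENNReal.ofReal_rpow_of_nonneg (by unfold lpDist; positivity) hp₀.le, edist_dist,
    PiLp.dist_eq_sum (by rwa [hpr])]
  simp only [hpr, lpDist, Real.dist_eq]

theorem tendsto_transportCost_lpDist_iff (hp : 1 ≤ p) {ι : Type*} {l : Filter ι} [l.NeBot]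
    [l.IsCountablyGenerated] {ν : ι → ProbabilityMeasure (Fin n → ℝ)}
    {μ : ProbabilityMeasure (Fin n → ℝ)} {z : Fin n → ℝ}
    (hν : ∀ᶠ i in l, ∫⁻ x, ENNReal.ofReal (lpDist p z x ^ p) ∂(ν i).toMeasure ≠ ∞) :
    Tendsto (fun i => transportCost (fun x y => ENNReal.ofReal (lpDist p x y ^ p))
      (ν i).toMeasure μ) l (𝓝 0) ↔
      ∫⁻ x, ENNReal.ofReal (lpDist p z x ^ p) ∂μ.toMeasure ≠ ∞ ∧
      Tendsto ν l (𝓝 μ) ∧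
        Tendsto (fun i => ∫⁻ x, ENNReal.ofReal (lpDist p z x ^ p) ∂(ν i).toMeasure) l
          (𝓝 (∫⁻ x, ENNReal.ofReal (lpDist p z x ^ p) ∂μ.toMeasure)) := by
  have : Fact (1 ≤ ENNReal.ofReal p) := ⟨by simpa using hp⟩
  let lpMetric : PseudoMetricSpace (Fin n → ℝ) :=
    PiLp.pseudoMetricSpaceToPi (ENNReal.ofReal p) fun _ => ℝ
  have hedist (x y : Fin n → ℝ) :
      @edist _ lpMetric.toPseudoEMetricSpace.toEDist x y ^ p = ENNReal.ofReal (lpDist p x y ^ p) :=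
    edist_toLp_rpow hp x y
  simp only [← hedist] at hν ⊢
  exact @tendsto_transportCost_edist_rpow_iff _ _ lpMetric _ _ p _ _ _ _ _ _ hp z hν

end LpDist

section TimeIntegrated

variable {p w : ℝ} {n d : ℕ}

theorem lpDist_rpow (hp : 0 < p) (x y : Fin n → ℝ) : lpDist p x y ^ p = ∑ i, |x i - y i| ^ p := by
  rw [lpDist, one_div, Real.rpow_inv_rpow (by positivity) hp.ne']

theorem continuous_lpDist_rpow (hp : 0 < p) (x : Fin n → ℝ) :
    Continuous fun y => lpDist p x y ^ p := by
  simp only [lpDist_rpow hp]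
  fun_prop (disch := exact hp.le)

theorem lpDist_rpow_eq_feature_add_time (hp : 0 < p) (z z' : Fin (d + 1) → ℝ) :
    lpDist p z z' ^ p = lpDist p (feature z) (feature z') ^ p + |time z - time z'| ^ p := by
  simp only [lpDist_rpow hp, Fin.sum_univ_castSucc, feature, time]

theorem weightedDist_rpow (hp : 0 < p) (hw : w ∈ Set.Icc (0 : ℝ) 1) (z z' : Fin (d + 1) → ℝ) :
    weightedDist p w z z' ^ p =
      w * lpDist p (feature z) (feature z') ^ p + (1 - w) * |time z - time z'| ^ p := by
  have := sub_nonneg.2 hw.2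
  have := hw.1
  rw [weightedDist, one_div, Real.rpow_inv_rpow _ hp.ne']
  rw [lpDist_rpow hp]
  positivity

theorem weightedDist_rpow_le (hp : 0 < p) (hw : w ∈ Set.Icc (0 : ℝ) 1) (z z' : Fin (d + 1) → ℝ) :
    weightedDist p w z z' ^ p ≤ lpDist p z z' ^ p := by
  rw [weightedDist_rpow hp hw, lpDist_rpow_eq_feature_add_time hp]
  refine add_le_add (mul_le_of_le_one_left ?_ hw.2) (mul_le_of_le_one_left ?_ ?_)
  · rw [lpDist_rpow hp]
    positivity
  · positivity
  · linarith [hw.1]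

theorem weightedDist_half_rpow (hp : 0 < p) (z z' : Fin (d + 1) → ℝ) :
    weightedDist p (1 / 2) z z' ^ p = 1 / 2 * lpDist p z z' ^ p := by
  rw [weightedDist_rpow hp (by norm_num), lpDist_rpow_eq_feature_add_time hp]
  ring

theorem mem_couplings_iff {α β : ProbabilityMeasure (Fin n → ℝ)}
    {π : ProbabilityMeasure ((Fin n → ℝ) × (Fin n → ℝ))} :
    π ∈ Couplings α β ↔ IsCoupling π.toMeasure α.toMeasure β.toMeasure := by
  refine ⟨fun ⟨hfst, hsnd⟩ => ⟨Measure.ext fun A hA => ?_, Measure.ext fun B hB => ?_⟩,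
    fun h => ⟨fun A hA => ?_, fun B hB => ?_⟩⟩
  · rw [Measure.fst_apply hA, ← Set.prod_univ, hfst A hA]
  · rw [Measure.snd_apply hB, ← Set.univ_prod, hsnd B hB]
  · rw [Set.prod_univ, ← Measure.fst_apply hA, h.fst_eq]
  · rw [Set.univ_prod, ← Measure.snd_apply hB, h.snd_eq]

theorem weightedWasserstein_eq_transportCost_rpow (α β : ProbabilityMeasure (Fin (d + 1) → ℝ)) :
    weightedWasserstein p w α β =
      transportCost (fun z z' => ENNReal.ofReal (weightedDist p w z z' ^ p))
        α.toMeasure β.toMeasure ^ (1 / p) := by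
  rw [weightedWasserstein]
  congr 1
  refine le_antisymm (le_iInf₂ fun π hπ => ?_) (le_iInf₂ fun π hπ =>
    (mem_couplings_iff.1 hπ).transportCost_le)
  exact iInf₂_le (⟨π, hπ.isProbabilityMeasure⟩ : ProbabilityMeasure _) (mem_couplings_iff.2 hπ)

theorem tiotDist_le_transportCost_rpow (hp : 0 < p) (α β : ProbabilityMeasure (Fin (d + 1) → ℝ)) :
    tiotDist p α β ≤ transportCost (fun z z' => ENNReal.ofReal (lpDist p z z' ^ p))
      α.toMeasure β.toMeasure ^ (1 / p) := by
  refine iSup₂_le fun w hw => ?_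
  rw [weightedWasserstein_eq_transportCost_rpow]
  gcongr
  exact transportCost_mono fun z z' => ENNReal.ofReal_le_ofReal (weightedDist_rpow_le hp hw z z')

theorem half_mul_transportCost_le_tiotDist_rpow (hp : 0 < p)
    (α β : ProbabilityMeasure (Fin (d + 1) → ℝ)) :
    2⁻¹ * transportCost (fun z z' => ENNReal.ofReal (lpDist p z z' ^ p)) α.toMeasure β.toMeasure ≤
      tiotDist p α β ^ p := by
  have hcost (z z' : Fin (d + 1) → ℝ) : ENNReal.ofReal (weightedDist p (1 / 2) z z' ^ p) =
      2⁻¹ * ENNReal.ofReal (lpDist p z z' ^ p) := by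
    rw [weightedDist_half_rpow hp, ENNReal.ofReal_mul (by norm_num), one_div,
      ENNReal.ofReal_inv_of_pos two_pos, ENNReal.ofReal_ofNat]
  calc _ = weightedWasserstein p (1 / 2) α β ^ p := by
        rw [weightedWasserstein_eq_transportCost_rpow, one_div p, ENNReal.rpow_inv_rpow hp.ne']
        simp only [hcost]
        rw [transportCost_const_mul (by simp) (by simp)]
    _ ≤ tiotDist p α β ^ p := by
        gcongr
        exact le_iSup₂ (f := fun w _ => weightedWasserstein p w α β) (1 / 2 : ℝ) (by norm_num)

theorem tendsto_tiotDist_iff (hp : 0 < p) {ι : Type*} {l : Filter ι}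
    {ν : ι → ProbabilityMeasure (Fin (d + 1) → ℝ)} {μ : ProbabilityMeasure (Fin (d + 1) → ℝ)} :
    Tendsto (fun i => tiotDist p (ν i) μ) l (𝓝 0) ↔
      Tendsto (fun i => transportCost (fun z z' => ENNReal.ofReal (lpDist p z z' ^ p))
        (ν i).toMeasure μ.toMeasure) l (𝓝 0) := by
  constructor <;> intro h
  · have hbound := ENNReal.Tendsto.const_mul (a := 2) (h.ennrpow_const p) (.inr (by simp))
    rw [ENNReal.zero_rpow_of_pos hp, mul_zero] at hbound
    refine tendsto_of_tendsto_of_tendsto_of_le_of_le tendsto_const_nhds hbound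
      (fun _ => zero_le) fun i => ?_
    rw [← ENNReal.inv_mul_le_iff two_ne_zero ENNReal.ofNat_ne_top]
    exact half_mul_transportCost_le_tiotDist_rpow hp (ν i) μ
  · have hbound := h.ennrpow_const (1 / p)
    rw [ENNReal.zero_rpow_of_pos (by positivity)] at hbound
    exact tendsto_of_tendsto_of_tendsto_of_le_of_le tendsto_const_nhds hbound
      (fun _ => zero_le) fun i => tiotDist_le_transportCost_rpow hp (ν i) μ

theorem tendsto_integral_lpDist_rpow_iff (hp : 0 < p) {ι : Type*} {l : Filter ι}
    {ν : ι → ProbabilityMeasure (Fin n → ℝ)} {μ : ProbabilityMeasure (Fin n → ℝ)}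
    (hν : ∀ i, ν i ∈ FiniteMoment p n) (hμ : μ ∈ FiniteMoment p n) (z : Fin n → ℝ) :
    Tendsto (fun i => ∫ x, lpDist p z x ^ p ∂(ν i).toMeasure) l
      (𝓝 (∫ x, lpDist p z x ^ p ∂μ.toMeasure)) ↔
    Tendsto (fun i => ∫⁻ x, ENNReal.ofReal (lpDist p z x ^ p) ∂(ν i).toMeasure) l
      (𝓝 (∫⁻ x, ENNReal.ofReal (lpDist p z x ^ p) ∂μ.toMeasure)) := by
  have htoReal (α : ProbabilityMeasure (Fin n → ℝ)) : ∫ x, lpDist p z x ^ p ∂α.toMeasure =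
      (∫⁻ x, ENNReal.ofReal (lpDist p z x ^ p) ∂α.toMeasure).toReal :=
    integral_eq_lintegral_of_nonneg_ae
      (.of_forall fun x => by simp only [Pi.zero_apply, lpDist_rpow hp]; positivity)
      (continuous_lpDist_rpow hp z).aestronglyMeasurable
  simp only [htoReal]
  exact ENNReal.tendsto_toReal_iff (fun i => (hν i z).ne) (hμ z).ne

theorem weaklyConvergesInPp_iff (hp : 0 < p) {μs : ℕ → ProbabilityMeasure (Fin n → ℝ)}
    {μ : ProbabilityMeasure (Fin n → ℝ)} (hμs : ∀ k, μs k ∈ FiniteMoment p n) :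
    WeaklyConvergesInPp p μs μ ↔ ∀ z : Fin n → ℝ,
      ∫⁻ x, ENNReal.ofReal (lpDist p z x ^ p) ∂μ.toMeasure ≠ ∞ ∧ Tendsto μs atTop (𝓝 μ) ∧
        Tendsto (fun k => ∫⁻ x, ENNReal.ofReal (lpDist p z x ^ p) ∂(μs k).toMeasure) atTop
          (𝓝 (∫⁻ x, ENNReal.ofReal (lpDist p z x ^ p) ∂μ.toMeasure)) := by
  constructor
  · rintro ⟨-, hμ, hweak, hmoment⟩ z
    exact ⟨(hμ z).ne, ProbabilityMeasure.tendsto_iff_forall_integral_tendsto.2 hweak,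
      (tendsto_integral_lpDist_rpow_iff hp hμs hμ z).1 (hmoment z)⟩
  · intro h
    have hμ : μ ∈ FiniteMoment p n := fun z => (h z).1.lt_top
    exact ⟨hμs, hμ, ProbabilityMeasure.tendsto_iff_forall_integral_tendsto.1 (h 0).2.1,
      fun z => (tendsto_integral_lpDist_rpow_iff hp hμs hμ z).2 (h z).2.2⟩

end TimeIntegrated

end TiOT

theorem mainTheorem3 (p : ℝ) (hp : 1 ≤ p) (d : ℕ)
    (μs : ℕ → ProbabilityMeasure (Fin (d + 1) → ℝ))
    (hμs : ∀ k, μs k ∈ TiOT.FiniteMoment p (d + 1))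
    (μ : ProbabilityMeasure (Fin (d + 1) → ℝ)) :
    TiOT.WeaklyConvergesInPp p μs μ ↔
      Tendsto (fun k => TiOT.tiotDist p (μs k) μ) atTop (𝓝 0) := by
  have hp₀ : 0 < p := by linarith
  rw [TiOT.weaklyConvergesInPp_iff hp₀ hμs, TiOT.tendsto_tiotDist_iff hp₀]
  simp only [← TiOT.tendsto_transportCost_lpDist_iff hp (.of_forall fun k => (hμs k _).ne),
    forall_const]
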